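/- Let $\Lambda$ be an Artin algebra, let $n\ge 0$ be an integer, and suppose that $\Lambda$ is a minimal $n$-Auslander-Gorenstein algebra, that is, $\operatorname{id}{}_\Lambda\Lambda\le n+1\le\operatorname{domdim}\Lambda$, where $\operatorname{id}{}_\Lambda\Lambda$ is the injective dimension of $\Lambda$ as a left module over itself and $\operatorname{domdim}\Lambda$ is the supremum of all $m$ such that the first $m$ terms $I_0,\dots,I_{m-1}$ of a minimal injective coresolution $0\to\Lambda\to I_0\to I_1\to\cdots$ of the left module $\Lambda$ are projective. All modules are finitely generated left modules. A module is Gorenstein projective if it is isomorphic to the kernel of a differential of an exact complex, indexed by $\mathbb Z$, of finitely generated projective modules that remains exact under $\operatorname{Hom}_\Lambda(-,\Lambda)$. The Gorenstein projective dimension $\operatorname{Gpd}N$ of a module $N$ is the least $m\ge 0$ for which there is an exact sequence $0\to G_m\to\cdots\to G_0\to N\to 0$ with all $G_i$ Gorenstein projective ($\infty$ if there is none). The socle $\operatorname{soc}N$ is the sum of all simple submodules of $N$. Then an injective $\Lambda$-module $I$ is projective if and only if $\operatorname{Gpd}(\operatorname{soc}I)\le n$. That is, the full subcategory $\operatorname{prinj}(\Lambda)$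 of projective-injective $\Lambda$-modules satisfies $$\operatorname{prinj}(\Lambda)=\{I\in\Lambda\text{-}\mathrm{mod} : I \text{ is injective and } \operatorname{Gpd}(\operatorname{soc}I)\le n\}.$$ -/

import Mathlib

universe u v

/-- The socle of a module: the sum of all its simple submodules. -/
def socle (Λ : Type u) [Ring Λ] (M : Type u) [AddCommGroup M] [Module Λ M] : Submodule Λ M :=
  sSup {S : Submodule Λ M | IsSimpleModule Λ S}

/-- A submodule is essential if it meets every nonzero submodule nontrivially. -/
def IsEssentialSubmodule {Λ : Type u} [Ring Λ] {M : Type u} [AddCommGroup M] [Module Λ M]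
    (N : Submodule Λ M) : Prop :=
  ∀ K : Submodule Λ M, N ⊓ K = ⊥ → K = ⊥

/-- A minimal injective coresolution `0 → M → I⁰ → I¹ → I² → ⋯` of `M` by finitely generated
injective modules: the sequence is exact, `I⁰` is an essential extension of the image of `M`, and
each `Iʲ⁺¹` is an essential extension of the image of `Iʲ`. -/
structure MinimalInjectiveCoresolution (Λ : Type u) [Ring Λ]
    (M : Type u) [AddCommGroup M] [Module Λ M] where
  /-- the terms `Iʲ` -/
  term : ℕ → ModuleCat.{u} Λ
  /-- the augmentation `M → I⁰` -/
  aug : M →ₗ[Λ] term 0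
  /-- the differentials `Iʲ → Iʲ⁺¹` -/
  d : ∀ j, term j →ₗ[Λ] term (j + 1)
  finite : ∀ j, Module.Finite Λ (term j)
  injective : ∀ j, Module.Injective Λ (term j)
  aug_injective : Function.Injective aug
  exact_zero : Function.Exact aug (d 0)
  exact_succ : ∀ j, Function.Exact (d j) (d (j + 1))
  essential_zero : IsEssentialSubmodule (LinearMap.range aug)
  essential_succ : ∀ j, IsEssentialSubmodule (LinearMap.range (d j))

/-- The dominant dimension of `Λ` (as a left module over itself): the supremum of all `m` such that
the first `m` terms `I⁰, …, Iᵐ⁻¹` of a minimal injective coresolution of `Λ` are projective. -/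
noncomputable def dominantDimension (Λ : Type u) [Ring Λ] : ℕ∞ :=
  sSup {x : ℕ∞ | ∃ m : ℕ, x = m ∧ ∃ I : MinimalInjectiveCoresolution Λ Λ,
    ∀ j < m, Module.Projective Λ (I.term j)}

/-- The condition `id _ΛΛ ≤ n + 1 ≤ domdim Λ`, which defines the minimal `n`-Auslander-Gorenstein
algebras among the Artin algebras. -/
def IsMinimalAuslanderGorenstein (Λ : Type u) [Ring Λ] (n : ℕ) : Prop :=
  CategoryTheory.injectiveDimension (ModuleCat.of Λ Λ) ≤ ((n + 1 : ℕ) : WithBot ℕ∞) ∧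
    ((n + 1 : ℕ) : ℕ∞) ≤ dominantDimension Λ

/-- A totally acyclic complex `⋯ → Pⁱ → Pⁱ⁺¹ → ⋯` (`i ∈ ℤ`): an exact complex of finitely generated
projective modules that stays exact under `Hom_Λ(-, Λ)`. -/
structure TotallyAcyclicComplex (Λ : Type u) [Ring Λ] where
  /-- the terms `Pⁱ` -/
  term : ℤ → ModuleCat.{u} Λ
  /-- the differentials `Pⁱ → Pⁱ⁺¹` -/
  d : ∀ i, term i →ₗ[Λ] term (i + 1)
  finite : ∀ i, Module.Finite Λ (term i)
  projective : ∀ i, Module.Projective Λ (term i)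
  exact : ∀ i, Function.Exact (d i) (d (i + 1))
  hom_exact : ∀ (i : ℤ) (f : term (i + 1) →ₗ[Λ] Λ), f ∘ₗ d i = 0 →
    ∃ g : term (i + 1 + 1) →ₗ[Λ] Λ, g ∘ₗ d (i + 1) = f

/-- A (finitely generated) module is Gorenstein projective if it is isomorphic to the module of
degree-zero cocycles of a totally acyclic complex. -/
def IsGorensteinProjective (Λ : Type u) [Ring Λ]
    (M : Type u) [AddCommGroup M] [Module Λ M] : Prop :=
  ∃ P : TotallyAcyclicComplex Λ, Nonempty (M ≃ₗ[Λ] LinearMap.ker (P.d 0))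

/-- `M` has a Gorenstein projective resolution `0 → Gₙ → ⋯ → G₁ → G₀ → M → 0` of length `n`
(built by splicing short exact sequences `0 → K → G₀ → M → 0`). -/
def HasGorensteinProjectiveResolution (Λ : Type u) [Ring Λ] :
    (n : ℕ) → (M : Type u) → [AddCommGroup M] → [Module Λ M] → Prop
  | 0, M, _, _ => IsGorensteinProjective Λ M
  | n + 1, M, _, _ => ∃ (K G : ModuleCat.{u} Λ) (i : K →ₗ[Λ] G) (p : G →ₗ[Λ] M),
      Function.Injective i ∧ Function.Exact i p ∧ Function.Surjective p ∧
        IsGorensteinProjective Λ G ∧ HasGorensteinProjectiveResolution Λ n K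

/-- The Gorenstein projective dimension: the least length of a Gorenstein projective resolution,
and `⊤` if there is none. -/
noncomputable def Gpd (Λ : Type u) [Ring Λ] (M : Type u) [AddCommGroup M] [Module Λ M] : ℕ∞ :=
  sInf {x : ℕ∞ | ∃ n : ℕ, x = n ∧ HasGorensteinProjectiveResolution Λ n M}

/-- The full subcategory of finitely generated modules that are both projective and injective. -/
def prinj (Λ : Type u) [Ring Λ] : CategoryTheory.ObjectProperty (ModuleCat.{u} Λ) :=
  fun I => Module.Finite Λ I ∧ Module.Projective Λ I ∧ Module.Injective Λ I

open CategoryTheory CategoryTheory.Abelian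

/-! ### Cosyzygies by projective-injective modules and their Ext classes -/

section Homological

variable {Λ : Type u} [Ring Λ]

/-! The two inequalities give an exact sequence 0 → Λ → I₀ → ⋯ → Iₙ → C₀ → 0 with all Iⱼ
projective-injective and C₀ injective. By `PrinjCosyzygy.exists_class`, Ext^{n+1}(D, Λ) is then
Hom(D, C₀) modulo the maps that factor through projective-injectives; the same holds for every
direct summand P of Λ and its cosyzygy C.

If I is projective-injective, every map soc I → C₀ extends to the projective I, so Ext^{n+1}(soc I,
Λ) = 0; higher Ext vanishes by injective dimension. Passing to syzygies gives Gpd ≤ n, provided that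
modules with no positive Ext into Λ are Gorenstein projective. Conversely, Gpd(soc I) ≤ n kills
Ext^{n+1}(S, Λ) for each simple S ⊆ I; if this forces a nonzero map from S to a
projective-injective, then I embeds in a projective-injective and splits off.

Both gaps are filled by `exists_injective_of_simple`, a counting argument. To the top of an
indecomposable projective P assign a simple in soc P if P is injective, and otherwise a simple in
soc C with no nonzero map to a projective-injective. Distinct tops get distinct simples, and there
are finitely many simples, so every simple occurs. -/

theorem prinj.projective {Q : ModuleCat.{u} Λ} (h : prinj Λ Q) : Projective Q :=
  have := h.2.1
  (IsProjective.iff_projective Q).1 this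

theorem prinj.injective {Q : ModuleCat.{u} Λ} (h : prinj Λ Q) : Injective Q :=
  have := h.2.2
  Module.injective_object_of_injective_module Λ Q

theorem prinj_iff {Q : ModuleCat.{u} Λ} :
    prinj Λ Q ↔ Module.Finite Λ Q ∧ Projective Q ∧ Injective Q := by
  refine ⟨fun h => ⟨h.1, h.projective, h.injective⟩, fun h => ⟨h.1, ?_, ?_⟩⟩
  · exact (IsProjective.iff_projective Q).2 h.2.1
  · have := h.2.2
    exact Module.injective_module_of_injective_object Λ Q

/-- `C` is a `k`-th cosyzygy of `X`, computed with projective-injective modules. -/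
inductive PrinjCosyzygy : ℕ → ModuleCat.{u} Λ → ModuleCat.{u} Λ → Prop
  | refl (X : ModuleCat.{u} Λ) : PrinjCosyzygy 0 X X
  | step {k : ℕ} {S : ShortComplex (ModuleCat.{u} Λ)} {C : ModuleCat.{u} Λ}
      (hS : S.ShortExact) (hJ : prinj Λ S.X₂) (h : PrinjCosyzygy k S.X₃ C) :
      PrinjCosyzygy (k + 1) S.X₁ C

/-- A morphism that factors through a projective-injective module. -/
def FactorsThroughPrinj {X Y : ModuleCat.{u} Λ} (f : X ⟶ Y) : Prop :=
  ∃ Q : ModuleCat.{u} Λ, prinj Λ Q ∧ ∃ (a : X ⟶ Q) (b : Q ⟶ Y), a ≫ b = f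

/-- Here ξ is the Yoneda class of the spliced sequence. The first clause uses projectivity of the
middle terms, the other two their injectivity. The module `J` in the second clause strengthens the
induction: vanishing after one more connecting map means lifting to the middle term, which becomes
the next `J`. Applications take `J = 0`. -/
theorem PrinjCosyzygy.exists_class {k : ℕ} {X C : ModuleCat.{u} Λ} (h : PrinjCosyzygy k X C) :
    ∃ ξ : Ext C X k,
      (∀ (Y : ModuleCat.{u} Λ) (j m : ℕ) (hm : k + j = m) (z : Ext C Y m),
        ∃ z' : Ext X Y j, ξ.comp z' hm = z) ∧
      (∀ (D J : ModuleCat.{u} Λ) (e : D ⟶ C) (p : J ⟶ X) (y : Ext D J k), prinj Λ J →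
        (Ext.mk₀ e).comp ξ (zero_add k) = y.comp (Ext.mk₀ p) (add_zero k) →
          FactorsThroughPrinj e) ∧
      (∀ (D : ModuleCat.{u} Λ) (z : Ext D X k),
        ∃ e : D ⟶ C, (Ext.mk₀ e).comp ξ (zero_add k) = z) := by
  induction h with
  | refl X =>
    refine ⟨Ext.mk₀ (𝟙 X), ?_, ?_, ?_⟩
    · intro Y j m hm z
      obtain rfl : j = m := by omega
      exact ⟨z, Ext.mk₀_id_comp z⟩
    · intro D J e p y hJ he
      obtain ⟨y, rfl⟩ := (Ext.mk₀_bijective D J).2 y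
      rw [Ext.mk₀_comp_mk₀, Ext.mk₀_comp_mk₀, Category.comp_id] at he
      exact ⟨J, hJ, y, p, ((Ext.mk₀_bijective _ _).1 he).symm⟩
    · intro D z
      obtain ⟨e, rfl⟩ := (Ext.mk₀_bijective _ _).2 z
      exact ⟨e, by simp⟩
  | @step k S C hS hJ h ih =>
    obtain ⟨ξ, ha, hb, hc⟩ := ih
    have := hJ.projective
    have := hJ.injective
    refine ⟨ξ.comp hS.extClass rfl, ?_, ?_, ?_⟩
    · intro Y j m hm z
      obtain ⟨z₁, rfl⟩ := ha Y (j + 1) m (by omega) z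
      obtain ⟨z₂, hz₂⟩ := Ext.contravariant_sequence_exact₃ hS Y z₁
        (Ext.eq_zero_of_projective _) (add_comm 1 j)
      refine ⟨z₂, ?_⟩
      rw [Ext.comp_assoc (h₂₃ := add_comm 1 j) (h := by omega), hz₂]
    · intro D J e p y hJ' he
      have : Injective J := hJ'.injective
      rw [Ext.eq_zero_of_injective y, Ext.zero_comp,
        ← Ext.comp_assoc (h₁₂ := zero_add k) (h := by omega)] at he
      obtain ⟨x, hx⟩ := Ext.covariant_sequence_exact₃ D hS _ rfl he
      exact hb D S.X₂ e S.g x hJ hx.symm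
    · intro D z
      obtain ⟨x, rfl⟩ := Ext.covariant_sequence_exact₁ D hS z (Ext.eq_zero_of_injective _) rfl
      obtain ⟨e, rfl⟩ := hc D x
      exact ⟨e, by rw [Ext.comp_assoc (h := by omega)]⟩

theorem PrinjCosyzygy.factorsThroughPrinj {k : ℕ} {X C D : ModuleCat.{u} Λ}
    (h : PrinjCosyzygy k X C) (hD : ∀ z : Ext D X k, z = 0) (e : D ⟶ C) :
    FactorsThroughPrinj e := by
  obtain ⟨ξ, -, hb, -⟩ := h.exists_class
  refine hb D (ModuleCat.of Λ PUnit) e 0 0 ?_ (by rw [hD (Ext.comp _ _ _), Ext.zero_comp])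
  have h0 := ModuleCat.isZero_of_subsingleton (ModuleCat.of Λ PUnit.{u + 1})
  exact prinj_iff.2 ⟨inferInstance, h0.projective, h0.injective⟩

/-- Each class is the pullback of ξ along some M → C. That map extends to I as C is injective, and
Ext of positive degree vanishes on the projective I. -/
theorem PrinjCosyzygy.ext_eq_zero {k : ℕ} {X C I M : ModuleCat.{u} Λ}
    (h : PrinjCosyzygy (k + 1) X C) (hC : Injective C) (hI : Projective I)
    (i : M ⟶ I) [Mono i] (z : Ext M X (k + 1)) : z = 0 := by
  obtain ⟨ξ, -, -, hc⟩ := h.exists_class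
  obtain ⟨e, rfl⟩ := hc M z
  rw [← Injective.comp_factorThru e i, ← Ext.mk₀_comp_mk₀,
    Ext.comp_assoc (h₂₃ := zero_add _) (h := by omega),
    Ext.eq_zero_of_projective ((Ext.mk₀ (Injective.factorThru e i)).comp ξ _), Ext.comp_zero]

theorem PrinjCosyzygy.ext_eq_zero_of_lt {k : ℕ} {X C D : ModuleCat.{u} Λ}
    (h : PrinjCosyzygy k X C) (hD : ∀ Q : ModuleCat.{u} Λ, prinj Λ Q → ∀ f : D ⟶ Q, f = 0) :
    ∀ i < k, ∀ z : Ext D X i, z = 0 := by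
  induction h with
  | refl X => intro i hi; omega
  | @step k S C hS hJ h ih =>
    have := hJ.injective
    intro i hi z
    obtain _ | i := i
    · obtain ⟨f, rfl⟩ := (Ext.mk₀_bijective _ _).2 z
      have := hS.mono_f
      rw [Ext.mk₀_eq_zero_iff, ← cancel_mono S.f, Limits.zero_comp]
      exact hD _ hJ _
    · obtain ⟨x, rfl⟩ := Ext.covariant_sequence_exact₁ D hS z (Ext.eq_zero_of_injective _) rfl
      rw [ih i (by omega) x, Ext.zero_comp]

theorem PrinjCosyzygy.injective {k : ℕ} {X C : ModuleCat.{u} Λ} (h : PrinjCosyzygy k X C)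
    (hX : HasInjectiveDimensionLT X (k + 1)) : Injective C := by
  induction h with
  | refl X => exact injective_iff_hasInjectiveDimensionLT_one.2 hX
  | @step k S C hS hJ h ih =>
    exact ih ((hS.hasInjectiveDimensionLT_X₃_iff k hJ.injective).2 hX)

theorem PrinjCosyzygy.finite {k : ℕ} {X C : ModuleCat.{u} Λ} (h : PrinjCosyzygy k X C)
    (hX : Module.Finite Λ X) : Module.Finite Λ C := by
  induction h with
  | refl X => exact hX
  | @step k S C hS hJ h ih =>
    have := hJ.1
    exact ih (Module.Finite.of_surjective S.g.hom hS.moduleCat_surjective_g)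

/-- A projective cokernel splits each short exact sequence, from the right end backwards. -/
theorem PrinjCosyzygy.prinj_of_prinj {k : ℕ} {X C : ModuleCat.{u} Λ} (h : PrinjCosyzygy k X C)
    (hC : prinj Λ C) : prinj Λ X := by
  induction h with
  | refl X => exact hC
  | @step k S C hS hJ h ih =>
    have hW := ih hC
    have := hW.projective
    have := hS.epi_g
    have := hS.mono_f
    have s := hS.splittingOfProjective
    have r : Retract S.X₁ S.X₂ := ⟨S.f, s.r, s.f_r⟩
    have := hJ.projective
    have := hJ.injective
    have := hJ.1
    refine prinj_iff.2 ⟨?_, r.projective, r.injective⟩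
    refine Module.Finite.of_surjective s.r.hom fun x => ⟨S.f x, ?_⟩
    exact congr($(s.f_r) x)

theorem ext_eq_zero_of_retract {X Y D : ModuleCat.{u} Λ} (r : Retract X Y) {i : ℕ}
    (h : ∀ z : Ext D Y i, z = 0) (z : Ext D X i) : z = 0 := by
  rw [← Ext.comp_mk₀_id z, ← r.retract, ← Ext.mk₀_comp_mk₀,
    ← Ext.comp_assoc (h₁₂ := add_zero _) (h := by omega), h (z.comp _ _), Ext.zero_comp]

theorem ext_eq_zero_of_retract_left {X Y D : ModuleCat.{u} Λ} (r : Retract X Y) {i : ℕ}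
    (h : ∀ z : Ext Y D i, z = 0) (z : Ext X D i) : z = 0 := by
  rw [← Ext.mk₀_id_comp z, ← r.retract, ← Ext.mk₀_comp_mk₀,
    Ext.comp_assoc (h₂₃ := zero_add _) (h := by omega), h (Ext.comp _ z _), Ext.comp_zero]

end Homological

/-! ### Fitting's lemma, local projectives and finiteness of the set of simples -/

section ModuleTheory

variable {Λ : Type u} [Ring Λ]

theorem exists_simple_submodule_le {M : Type u} [AddCommGroup M] [Module Λ M] [IsArtinian Λ M]
    {K : Submodule Λ M} (hK : K ≠ ⊥) : ∃ S : Submodule Λ M, IsSimpleModule Λ S ∧ S ≤ K := by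
  obtain h | ⟨S, hS, hle⟩ := eq_bot_or_exists_atom_le K
  · exact (hK h).elim
  · exact ⟨S, isSimpleModule_iff_isAtom.2 hS, hle⟩

/-- A projective module all of whose endomorphisms are nilpotent or bijective has at most one
simple quotient. -/
theorem nonempty_linearEquiv_of_simple_quotients {P S₁ S₂ : Type u}
    [AddCommGroup P] [Module Λ P] [AddCommGroup S₁] [Module Λ S₁] [AddCommGroup S₂] [Module Λ S₂]
    [Module.Projective Λ P] [IsSimpleModule Λ S₁] [IsSimpleModule Λ S₂]
    (hP : ∀ f : Module.End Λ P, IsNilpotent f ∨ Function.Bijective f)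
    (p₁ : P →ₗ[Λ] S₁) (p₂ : P →ₗ[Λ] S₂) (h₁ : p₁ ≠ 0) (h₂ : p₂ ≠ 0) :
    Nonempty (S₁ ≃ₗ[Λ] S₂) := by
  have hle : LinearMap.ker p₂ ≤ LinearMap.ker p₁ := by
    by_contra hle
    have hne : p₁ ∘ₗ (LinearMap.ker p₂).subtype ≠ 0 := by
      intro h0
      exact hle fun x hx => congr($h0 ⟨x, hx⟩)
    obtain ⟨g, hg⟩ := Module.projective_lifting_property _ p₁ (LinearMap.surjective_of_ne_zero hne)
    -- φ satisfies p₁φ = p₁ and p₂φ = 0, so it is neither nilpotent nor surjective.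
    set φ : Module.End Λ P := (LinearMap.ker p₂).subtype ∘ₗ g with hφ
    have hφ₁ : ∀ x, p₁ (φ x) = p₁ x := fun x => congr($hg x)
    have hφ₂ : ∀ x, p₂ (φ x) = 0 := fun x => (g x).2
    obtain ⟨m, hm⟩ | hb := hP φ
    · refine h₁ (LinearMap.ext fun x => ?_)
      have key : ∀ k x, p₁ ((φ ^ k) x) = p₁ x := by
        intro k
        induction k with
        | zero => intro x; rfl
        | succ k ih => intro x; rw [pow_succ', Module.End.mul_apply, hφ₁, ih]
      rw [← key m x, hm]
      simp
    · refine h₂ (LinearMap.ext fun x => ?_)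
      obtain ⟨y, rfl⟩ := hb.2 x
      exact hφ₂ y
  let e := p₂.quotKerEquivOfSurjective (LinearMap.surjective_of_ne_zero h₂)
  let q : S₂ →ₗ[Λ] S₁ := (Submodule.liftQ _ p₁ hle) ∘ₗ e.symm.toLinearMap
  have hq : q ≠ 0 := by
    intro h0
    refine h₁ (LinearMap.ext fun x => ?_)
    have hx : q (e (Submodule.Quotient.mk x)) = p₁ x := by simp [q]
    rw [← hx, h0]
    rfl
  exact ⟨(LinearEquiv.ofBijective q (LinearMap.bijective_of_ne_zero hq)).symm⟩

/-- Fitting's decomposition into the kernel and the range of a high power. -/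
theorem isNilpotent_or_bijective_of_indecomposable {P : Type u} [AddCommGroup P] [Module Λ P]
    [IsArtinian Λ P] [IsNoetherian Λ P]
    (h : ∀ K K' : Submodule Λ P, IsCompl K K' → K = ⊤ ∨ K' = ⊤) (f : Module.End Λ P) :
    IsNilpotent f ∨ Function.Bijective f := by
  obtain ⟨n, hn, h0⟩ :=
    (f.eventually_isCompl_ker_pow_range_pow.and (Filter.eventually_ne_atTop 0)).exists
  obtain hk | hr := h _ _ hn
  · exact Or.inl ⟨n, LinearMap.ker_eq_top.1 hk⟩
  · right
    have hk : LinearMap.ker (f ^ n) = ⊥ := by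
      have := hn.disjoint
      rwa [hr, disjoint_top] at this
    have hb : IsUnit (f ^ n) := by
      rw [Module.End.isUnit_iff]
      exact ⟨LinearMap.ker_eq_bot.1 hk, LinearMap.range_eq_top.1 hr⟩
    exact (Module.End.isUnit_iff f).1 ((isUnit_pow_iff h0).1 hb)

/-- Every simple module is a quotient of a direct summand of `Λ` with local endomorphism ring. -/
theorem exists_local_retract [IsArtinianRing Λ] (S : Type u) [AddCommGroup S] [Module Λ S]
    [IsSimpleModule Λ S] :
    ∃ P : ModuleCat.{u} Λ, Nonempty (Retract P (ModuleCat.of Λ Λ)) ∧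
      (∀ f : Module.End Λ P, IsNilpotent f ∨ Function.Bijective f) ∧
        ∃ p : P →ₗ[Λ] S, p ≠ 0 := by
  let A : Set (ModuleCat.{u} Λ) :=
    {P | Nonempty (Retract P (ModuleCat.of Λ Λ)) ∧ ∃ p : P →ₗ[Λ] S, p ≠ 0}
  have hA : A.Nonempty := by
    refine ⟨ModuleCat.of Λ Λ, ⟨Retract.refl _⟩, ?_⟩
    have := IsSimpleModule.nontrivial Λ S
    obtain ⟨s, hs⟩ := exists_ne (0 : S)
    refine ⟨LinearMap.toSpanSingleton Λ S s, fun h0 => hs ?_⟩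
    simpa using congr($h0 (1 : Λ))
  -- A summand of least length with a nonzero map to S is indecomposable: in any decomposition one
  -- summand still maps nontrivially.
  obtain ⟨P, ⟨⟨r⟩, p, hp⟩, hmin⟩ :=
    WellFounded.has_min (InvImage.wf (fun P : ModuleCat.{u} Λ => Module.length Λ P)
      wellFounded_lt) A hA
  have hinj : Function.Injective r.i.hom := by
    intro x y hxy
    have h : ∀ z, r.r.hom (r.i.hom z) = z := fun z => congr(($(r.retract)).hom z)
    rw [← h x, hxy, h y]
  have : IsArtinian Λ P := isArtinian_of_injective r.i.hom hinj
  have : IsNoetherian Λ P := isNoetherian_of_injective r.i.hom hinj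
  have key : ∀ K K' : Submodule Λ P, IsCompl K K' → p ∘ₗ K.subtype ≠ 0 → K = ⊤ := by
    intro K K' hK hp'
    by_contra hne
    refine hmin (ModuleCat.of Λ K) ⟨⟨Retract.trans ?_ r⟩, _, hp'⟩ (Submodule.length_lt hne)
    refine ⟨ModuleCat.ofHom K.subtype, ModuleCat.ofHom (Submodule.projectionOnto K K' hK), ?_⟩
    ext x
    exact congrArg Subtype.val (Submodule.projectionOnto_apply_left hK x)
  refine ⟨P, ⟨r⟩, isNilpotent_or_bijective_of_indecomposable fun K K' hK => ?_, p, hp⟩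
  by_cases h : p ∘ₗ K.subtype = 0
  · refine Or.inr (key K' K hK.symm fun h' => hp (LinearMap.ext fun x => ?_))
    obtain ⟨y, hy, z, hz, rfl⟩ := Submodule.mem_sup.1 (hK.sup_eq_top ▸ Submodule.mem_top (x := x))
    rw [map_add, show p y = 0 from congr($h ⟨y, hy⟩), show p z = 0 from congr($h' ⟨z, hz⟩)]
    simp
  · exact Or.inl (key K K' hK h)

theorem IsFiniteLength.exists_finite_simple_quotients {M : Type u} [AddCommGroup M] [Module Λ M]
    (h : IsFiniteLength Λ M) :
    ∃ A : Set (ModuleCat.{u} Λ), A.Finite ∧ ∀ T : ModuleCat.{u} Λ, IsSimpleModule Λ T →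
      (∃ f : M →ₗ[Λ] T, f ≠ 0) → ∃ B ∈ A, Nonempty (T ≃ₗ[Λ] B) := by
  induction h with
  | of_subsingleton =>
    refine ⟨∅, Set.finite_empty, fun T _ ⟨f, hf⟩ => (hf ?_).elim⟩
    ext x
    rw [Subsingleton.elim x 0, map_zero, map_zero]
  | @of_simple_quotient M _ _ N hs _ ih =>
    obtain ⟨A, hA, hT⟩ := ih
    refine ⟨insert (ModuleCat.of Λ (M ⧸ N)) A, hA.insert _, fun T hT' ⟨f, hf⟩ => ?_⟩
    by_cases h0 : f ∘ₗ N.subtype = 0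
    · refine ⟨_, Set.mem_insert _ _, ?_⟩
      have hle : N ≤ LinearMap.ker f := fun x hx => congr($h0 ⟨x, hx⟩)
      have hne : N.liftQ f hle ≠ 0 := fun h => hf (by rw [← N.liftQ_mkQ f hle, h]; rfl)
      exact ⟨(LinearEquiv.ofBijective _ (LinearMap.bijective_of_ne_zero hne)).symm⟩
    · obtain ⟨B, hB, e⟩ := hT T hT' ⟨_, h0⟩
      exact ⟨B, Set.mem_insert_of_mem _ hB, e⟩

/-- An injective self-map of a finite set is surjective, applied to a choice of values on
representatives; `r` need not respect `s`. -/
theorem exists_of_total_relation {α : Type*} (s : Setoid α) [Finite (Quotient s)]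
    (r : α → α → Prop) (htot : ∀ a, ∃ b, r a b)
    (hinj : ∀ a b a' b', r a a' → r b b' → s a' b' → s a b) (t : α) : ∃ a b, r a b ∧ s b t := by
  choose f hf using htot
  let g : Quotient s → Quotient s := fun q => Quotient.mk s (f q.out)
  have hg : Function.Injective g := by
    intro p q hpq
    have := hinj _ _ _ _ (hf p.out) (hf q.out) (Quotient.exact hpq)
    rw [← Quotient.out_eq p, ← Quotient.out_eq q]
    exact Quotient.sound this
  obtain ⟨q, hq⟩ := Finite.surjective_of_injective hg (Quotient.mk s t)
  exact ⟨_, _, hf q.out, Quotient.exact hq⟩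

/-- Isomorphism of simple modules. -/
def simpleSetoid (Λ : Type u) [Ring Λ] : Setoid {S : ModuleCat.{u} Λ // IsSimpleModule Λ S} where
  r S T := Nonempty (S.1 ≃ₗ[Λ] T.1)
  iseqv := ⟨fun _ => ⟨.refl _ _⟩, fun ⟨e⟩ => ⟨e.symm⟩, fun ⟨e⟩ ⟨f⟩ => ⟨e.trans f⟩⟩

theorem finite_simpleSetoid [IsArtinianRing Λ] : Finite (Quotient (simpleSetoid Λ)) := by
  obtain ⟨A, hA, h⟩ := ((isArtinianRing_iff_isFiniteLength Λ).1
    (inferInstance : IsArtinianRing Λ)).exists_finite_simple_quotients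
  have key : ∀ S : {S : ModuleCat.{u} Λ // IsSimpleModule Λ S},
      ∃ B : A, Nonempty (S.1 ≃ₗ[Λ] B.1) := by
    intro S
    have := S.2
    have := IsSimpleModule.nontrivial Λ S.1
    obtain ⟨s, hs⟩ := exists_ne (0 : S.1)
    obtain ⟨B, hB, e⟩ := h S.1 S.2
      ⟨LinearMap.toSpanSingleton Λ S.1 s, fun h0 => hs (by simpa using congr($h0 (1 : Λ)))⟩
    exact ⟨⟨B, hB⟩, e⟩
  choose B hB using key
  have := hA.to_subtype
  refine Finite.of_injective (fun q : Quotient (simpleSetoid Λ) => B q.out) fun p q hpq => ?_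
  rw [← Quotient.out_eq p, ← Quotient.out_eq q]
  obtain ⟨e⟩ := hB p.out
  obtain ⟨f⟩ := hB q.out
  have hpq : B p.out = B q.out := hpq
  rw [hpq] at e
  exact Quotient.sound ⟨e.trans f.symm⟩

end ModuleTheory

/-! ### Embeddings into projective-injective modules -/

section PrinjEmbedding

variable {Λ : Type u} [Ring Λ]

/-- A module is torsion with respect to the projective-injective modules if it has no nonzero
homomorphism to any of them. -/
def IsPrinjTorsion (D : ModuleCat.{u} Λ) : Prop :=
  ∀ Q : ModuleCat.{u} Λ, prinj Λ Q → ∀ f : D ⟶ Q, f = 0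

theorem prinj_prod {P Q : ModuleCat.{u} Λ} (hP : prinj Λ P) (hQ : prinj Λ Q) :
    prinj Λ (ModuleCat.of Λ (P × Q)) := by
  obtain ⟨_, _, h₁⟩ := hP
  obtain ⟨_, _, h₂⟩ := hQ
  refine ⟨inferInstanceAs (Module.Finite Λ (P × Q)),
    inferInstanceAs (Module.Projective Λ (P × Q)), ⟨fun X Y _ _ _ _ f hf g => ?_⟩⟩
  obtain ⟨a, ha⟩ := h₁.out f hf (LinearMap.fst Λ P Q ∘ₗ g)
  obtain ⟨b, hb⟩ := h₂.out f hf (LinearMap.snd Λ P Q ∘ₗ g)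
  exact ⟨a.prod b, fun x => Prod.ext (ha x) (hb x)⟩

/-- A map with minimal kernel is injective: a simple in the kernel is detected by another map, and
pairing the two shrinks the kernel. -/
theorem exists_mono_prinj (X : ModuleCat.{u} Λ) [IsArtinian Λ X]
    (h : ∀ S : Submodule Λ X, IsSimpleModule Λ S → ¬ IsPrinjTorsion (ModuleCat.of Λ S)) :
    ∃ Q : ModuleCat.{u} Λ, prinj Λ Q ∧ ∃ f : X ⟶ Q, Mono f := by
  let A : Set (Submodule Λ X) :=
    {K | ∃ Q : ModuleCat.{u} Λ, prinj Λ Q ∧ ∃ f : X →ₗ[Λ] Q, LinearMap.ker f = K}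
  have hA : A.Nonempty := by
    have h0 := ModuleCat.isZero_of_subsingleton (ModuleCat.of Λ PUnit.{u + 1})
    exact ⟨_, ModuleCat.of Λ PUnit,
      prinj_iff.2 ⟨inferInstance, h0.projective, h0.injective⟩, 0, rfl⟩
  obtain ⟨K, ⟨Q, hQ, f, rfl⟩, hmin⟩ := IsArtinian.set_has_minimal A hA
  refine ⟨Q, hQ, ModuleCat.ofHom f, ?_⟩
  rw [ModuleCat.mono_iff_ker_eq_bot]
  by_contra hne
  obtain ⟨S, hS, hle⟩ := exists_simple_submodule_le hne
  have hS' := h S hS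
  unfold IsPrinjTorsion at hS'
  push Not at hS'
  obtain ⟨J, hJ, g, hg⟩ := hS'
  obtain ⟨g', hg'⟩ := hJ.2.2.out S.subtype S.injective_subtype g.hom
  refine hmin (LinearMap.ker (f.prod g')) ⟨_, prinj_prod hQ hJ, _, rfl⟩ ?_
  rw [LinearMap.ker_prod]
  refine lt_of_le_of_ne inf_le_left fun heq => hg ?_
  ext x
  have hx : (x : X) ∈ LinearMap.ker g' := (inf_eq_left.1 heq) (hle x.2)
  exact (hg' x).symm.trans hx

/-- A converse to `PrinjCosyzygy.ext_eq_zero_of_lt`. Unlike a resolution, the Ext condition visibly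
passes to direct summands. -/
theorem PrinjCosyzygy.exists_of_ext_eq_zero [IsArtinianRing Λ] (k : ℕ)
    (X : ModuleCat.{u} Λ) (hX : Module.Finite Λ X)
    (h : ∀ S : ModuleCat.{u} Λ, IsSimpleModule Λ S → IsPrinjTorsion S →
      ∀ i < k, ∀ z : Ext S X i, z = 0) :
    ∃ C, PrinjCosyzygy k X C := by
  induction k generalizing X with
  | zero => exact ⟨X, .refl X⟩
  | succ k ih =>
    obtain ⟨Q, hQ, f, hf⟩ := exists_mono_prinj X fun S hS hT => by
      have := h (ModuleCat.of Λ S) hS hT 0 k.succ_pos (Ext.mk₀ (ModuleCat.ofHom S.subtype))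
      rw [Ext.mk₀_eq_zero_iff] at this
      have h0 : S = ⊥ := by
        rw [← S.range_subtype, LinearMap.range_eq_bot]
        exact congr(($this).hom)
      have := IsSimpleModule.nontrivial Λ S
      exact (Submodule.nontrivial_iff_ne_bot.1 this) h0
    let T : ShortComplex (ModuleCat.{u} Λ) := .mk f (Limits.cokernel.π f) (by simp)
    have hT : T.ShortExact := { exact := ShortComplex.exact_cokernel f }
    have := hQ.injective
    obtain ⟨C, hC⟩ := ih T.X₃
      (have := hQ.1; Module.Finite.of_surjective T.g.hom hT.moduleCat_surjective_g)
      fun S hS hS' i hi z => by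
        have hz := h S hS hS' (i + 1) (by omega) (z.comp hT.extClass rfl)
        obtain ⟨y, rfl⟩ := Ext.covariant_sequence_exact₃ S hT z rfl hz
        have hy : y = 0 := by
          obtain _ | i := i
          · obtain ⟨y, rfl⟩ := (Ext.mk₀_bijective _ _).2 y
            rw [hS' Q hQ y, Ext.mk₀_zero]
          · exact Ext.eq_zero_of_injective (I := Q) y
        rw [hy, Ext.zero_comp]
    exact ⟨C, .step hT hQ hC⟩

end PrinjEmbedding

/-! ### Matching simple tops with simple socles -/

section SimpleModules

variable {Λ : Type u} [Ring Λ]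

theorem mono_of_isSimpleModule {T X : ModuleCat.{u} Λ} [IsSimpleModule Λ T] {i : T ⟶ X}
    (hi : i ≠ 0) : Mono i := by
  rw [ModuleCat.mono_iff_injective]
  exact LinearMap.injective_of_ne_zero (f := i.hom) fun h => hi (ModuleCat.hom_ext h)

theorem prinj_of_retract {P Q : ModuleCat.{u} Λ} (r : Retract P Q) (hQ : prinj Λ Q) :
    prinj Λ P := by
  have := hQ.projective
  have := hQ.injective
  have := hQ.1
  refine prinj_iff.2 ⟨Module.Finite.of_surjective r.r.hom fun x => ⟨r.i x, ?_⟩,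
    r.projective, r.injective⟩
  exact congr($(r.retract) x)

theorem retract_self_finite_projective {P : ModuleCat.{u} Λ} (r : Retract P (ModuleCat.of Λ Λ)) :
    Module.Finite Λ P ∧ Projective P := by
  have : Projective (ModuleCat.of Λ Λ) :=
    (IsProjective.iff_projective (ModuleCat.of Λ Λ)).1 (inferInstanceAs (Module.Projective Λ Λ))
  exact ⟨Module.Finite.of_surjective r.r.hom fun x => ⟨r.i x, congr($(r.retract) x)⟩,
    r.projective⟩

/-- The simple module `T` occurs in the socle of `P`, or of its `(n + 1)`-st cosyzygy, where `P`
is the indecomposable projective module with top `S`. -/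
def CosyzygySocleRel (n : ℕ) (S T : ModuleCat.{u} Λ) : Prop :=
  ∃ P : ModuleCat.{u} Λ, Nonempty (Retract P (ModuleCat.of Λ Λ)) ∧
    (∀ f : Module.End Λ P, IsNilpotent f ∨ Function.Bijective f) ∧
    (∃ p : P →ₗ[Λ] S, p ≠ 0) ∧
      ((prinj Λ P ∧ ∃ i : T ⟶ P, i ≠ 0) ∨
        (IsPrinjTorsion T ∧ ∃ C : ModuleCat.{u} Λ, Injective C ∧ PrinjCosyzygy (n + 1) P C ∧
          ∃ i : T ⟶ C, i ≠ 0))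

theorem PrinjCosyzygy.exists_of_retract [IsArtinianRing Λ] {k : ℕ} {C₀ P : ModuleCat.{u} Λ}
    (hdom : PrinjCosyzygy k (ModuleCat.of Λ Λ) C₀)
    (hid : HasInjectiveDimensionLT (ModuleCat.of Λ Λ) (k + 1))
    (r : Retract P (ModuleCat.of Λ Λ)) :
    ∃ C : ModuleCat.{u} Λ, Injective C ∧ Module.Finite Λ C ∧ PrinjCosyzygy k P C := by
  have hP := (retract_self_finite_projective r).1
  obtain ⟨C, hC⟩ := PrinjCosyzygy.exists_of_ext_eq_zero k P hP fun S _ hS i hi =>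
    ext_eq_zero_of_retract r (hdom.ext_eq_zero_of_lt hS i hi)
  exact ⟨C, hC.injective (r.hasInjectiveDimensionLT _), hC.finite hP, hC⟩

theorem CosyzygySocleRel.total [IsArtinianRing Λ] {n : ℕ} {C₀ : ModuleCat.{u} Λ}
    (hdom : PrinjCosyzygy (n + 1) (ModuleCat.of Λ Λ) C₀)
    (hid : HasInjectiveDimensionLT (ModuleCat.of Λ Λ) (n + 2))
    (S : ModuleCat.{u} Λ) (hS : IsSimpleModule Λ S) :
    ∃ T : ModuleCat.{u} Λ, IsSimpleModule Λ T ∧ CosyzygySocleRel n S T := by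
  obtain ⟨P, ⟨r⟩, hloc, p, hp⟩ := exists_local_retract (Λ := Λ) S
  obtain ⟨hfin, hproj⟩ := retract_self_finite_projective r
  by_cases hP : prinj Λ P
  · have htop : (⊤ : Submodule Λ P) ≠ ⊥ := by
      intro h
      refine hp (LinearMap.ext fun x => ?_)
      have hx : x ∈ (⊥ : Submodule Λ P) := h ▸ Submodule.mem_top
      rw [(Submodule.mem_bot Λ).1 hx, map_zero, map_zero]
    obtain ⟨T, hT, -⟩ := exists_simple_submodule_le htop
    refine ⟨ModuleCat.of Λ T, hT, P, ⟨r⟩, hloc, ⟨p, hp⟩, Or.inl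
      ⟨hP, ModuleCat.ofHom T.subtype, fun h0 => ?_⟩⟩
    have := IsSimpleModule.nontrivial Λ T
    refine Submodule.nontrivial_iff_ne_bot.1 this ?_
    rw [← T.range_subtype, LinearMap.range_eq_bot]
    exact congr(($h0).hom)
  · obtain ⟨C, hC, hCfin, hPC⟩ := hdom.exists_of_retract hid r
    by_contra hno
    refine hP (hPC.prinj_of_prinj ?_)
    obtain ⟨Q, hQ, f, hf⟩ := exists_mono_prinj C fun T hT hT' => by
      refine hno ⟨ModuleCat.of Λ T, hT, P, ⟨r⟩, hloc, ⟨p, hp⟩, Or.inr ⟨hT', C, hC, hPC,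
        ModuleCat.ofHom T.subtype, fun h0 => ?_⟩⟩
      have := IsSimpleModule.nontrivial Λ T
      refine Submodule.nontrivial_iff_ne_bot.1 this ?_
      rw [← T.range_subtype, LinearMap.range_eq_bot]
      exact congr(($h0).hom)
    exact prinj_of_retract ⟨f, Injective.factorThru (𝟙 C) f, Injective.comp_factorThru _ _⟩ hQ

/-- Extending the embeddings of T gives maps C₁ → C₂ → C₁ whose composite fixes T; through ξ₁ and ξ₂
they correspond to f and f'. If a power of the composite P₁ → P₁ were zero, some w fixing T would
pull ξ₁ back to zero, hence factor through a projective-injective and kill T. -/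
theorem CosyzygySocleRel.not_nilpotent {T P₁ P₂ C₁ C₂ : ModuleCat.{u} Λ} {k : ℕ}
    (hT : IsPrinjTorsion T) (h₁ : PrinjCosyzygy k P₁ C₁) (h₂ : PrinjCosyzygy k P₂ C₂)
    (hC₁ : Injective C₁) (hC₂ : Injective C₂) (i₁ : T ⟶ C₁) (i₂ : T ⟶ C₂) [Mono i₁] [Mono i₂]
    (hi₁ : i₁ ≠ 0) :
    ∃ (f : P₁ ⟶ P₂) (f' : P₂ ⟶ P₁), ¬ IsNilpotent (f'.hom ∘ₗ f.hom : Module.End Λ P₁) := by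
  obtain ⟨ξ₁, ha₁, hb₁, -⟩ := h₁.exists_class
  obtain ⟨ξ₂, ha₂, -, -⟩ := h₂.exists_class
  obtain ⟨f, hf⟩ := ha₁ P₂ 0 k rfl ((Ext.mk₀ (Injective.factorThru i₂ i₁)).comp ξ₂ (zero_add k))
  obtain ⟨f', hf'⟩ := ha₂ P₁ 0 k rfl ((Ext.mk₀ (Injective.factorThru i₁ i₂)).comp ξ₁ (zero_add k))
  obtain ⟨f, rfl⟩ := (Ext.mk₀_bijective _ _).2 f
  obtain ⟨f', rfl⟩ := (Ext.mk₀_bijective _ _).2 f'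
  refine ⟨f, f', fun ⟨m, hm⟩ => ?_⟩
  set v : C₁ ⟶ C₁ := Injective.factorThru i₂ i₁ ≫ Injective.factorThru i₁ i₂ with hv
  have hiv : i₁ ≫ v = i₁ := by simp [hv]
  have hξ : (Ext.mk₀ v).comp ξ₁ (zero_add k) = ξ₁.comp (Ext.mk₀ (f ≫ f')) (add_zero k) := by
    rw [hv, ← Ext.mk₀_comp_mk₀_assoc, ← hf', ← Ext.comp_assoc (h₁₂ := zero_add k) (h := by omega),
      ← hf, Ext.comp_assoc_of_third_deg_zero, Ext.mk₀_comp_mk₀]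
  have key : ∀ m : ℕ, ∃ w : C₁ ⟶ C₁, i₁ ≫ w = i₁ ∧ (Ext.mk₀ w).comp ξ₁ (zero_add k) =
      ξ₁.comp (Ext.mk₀ (ModuleCat.ofHom ((f'.hom ∘ₗ f.hom : Module.End Λ P₁) ^ m)))
        (add_zero k) := by
    intro m
    induction m with
    | zero =>
      refine ⟨𝟙 _, by simp, ?_⟩
      have : ModuleCat.ofHom ((f'.hom ∘ₗ f.hom : Module.End Λ P₁) ^ 0) = 𝟙 P₁ := rfl
      rw [this]
      simp
    | succ m ih =>
      obtain ⟨w, hw, hw'⟩ := ih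
      refine ⟨v ≫ w, by rw [← Category.assoc, hiv, hw], ?_⟩
      have : ModuleCat.ofHom ((f'.hom ∘ₗ f.hom : Module.End Λ P₁) ^ (m + 1)) =
          (f ≫ f') ≫ ModuleCat.ofHom ((f'.hom ∘ₗ f.hom : Module.End Λ P₁) ^ m) := by
        rw [pow_succ]
        rfl
      rw [this, ← Ext.mk₀_comp_mk₀_assoc, hw', ← Ext.comp_assoc_of_third_deg_zero, hξ,
        Ext.comp_assoc_of_third_deg_zero, Ext.mk₀_comp_mk₀]
  obtain ⟨w, hw, hw'⟩ := key m
  rw [hm] at hw'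
  have h0 : (Ext.mk₀ w).comp ξ₁ (zero_add k) = 0 := by
    have hz : ModuleCat.ofHom (0 : Module.End Λ P₁) = 0 := rfl
    rw [hw', hz, Ext.mk₀_zero, Ext.comp_zero]
  have h00 := ModuleCat.isZero_of_subsingleton (ModuleCat.of Λ PUnit.{u + 1})
  obtain ⟨Q, hQ, a, b, hab⟩ := hb₁ C₁ (ModuleCat.of Λ PUnit) w 0 0
    (prinj_iff.2 ⟨inferInstance, h00.projective, h00.injective⟩) (by rw [h0, Ext.zero_comp])
  refine hi₁ ?_
  rw [← hw, ← hab, ← Category.assoc, hT Q hQ (i₁ ≫ a), Limits.zero_comp]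

theorem CosyzygySocleRel.injective {n : ℕ} {S₁ S₂ T₁ T₂ : ModuleCat.{u} Λ}
    (hS₁ : IsSimpleModule Λ S₁)
    (hS₂ : IsSimpleModule Λ S₂) (hT₁ : IsSimpleModule Λ T₁) (hT₂ : IsSimpleModule Λ T₂)
    (h₁ : CosyzygySocleRel n S₁ T₁) (h₂ : CosyzygySocleRel n S₂ T₂)
    (e : T₁ ≅ T₂) : Nonempty (S₁ ≃ₗ[Λ] S₂) := by
  obtain ⟨P₁, ⟨r₁⟩, hl₁, ⟨p₁, hp₁⟩, h₁⟩ := h₁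
  obtain ⟨P₂, ⟨r₂⟩, hl₂, ⟨p₂, hp₂⟩, h₂⟩ := h₂
  suffices h : ∃ (f : P₁ ⟶ P₂) (f' : P₂ ⟶ P₁),
      ¬ IsNilpotent (f'.hom ∘ₗ f.hom : Module.End Λ P₁) by
    obtain ⟨f, f', hn⟩ := h
    -- The endomorphism is bijective, so P₂ maps onto P₁ and thus onto S₁; but P₂ has only one
    -- simple quotient.
    have hs : Function.Surjective f'.hom :=
      Function.Surjective.of_comp ((hl₁ _).resolve_left hn).2
    have : Module.Projective Λ P₂ :=
      (IsProjective.iff_projective P₂).2 (retract_self_finite_projective r₂).2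
    refine nonempty_linearEquiv_of_simple_quotients hl₂ (p₁ ∘ₗ f'.hom) p₂ (fun h0 => hp₁ ?_) hp₂
    ext x
    obtain ⟨y, rfl⟩ := hs x
    exact congr($h0 y)
  obtain ⟨hP₁, i₁, hi₁⟩ | ⟨ht₁, C₁, hC₁, hc₁, i₁, hi₁⟩ := h₁ <;>
  obtain ⟨hP₂, i₂, hi₂⟩ | ⟨ht₂, C₂, hC₂, hc₂, i₂, hi₂⟩ := h₂
  · have := mono_of_isSimpleModule hi₁
    have := mono_of_isSimpleModule hi₂
    have := hP₁.injective
    have := hP₂.injective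
    let f : P₁ ⟶ P₂ := Injective.factorThru (e.hom ≫ i₂) i₁
    let f' : P₂ ⟶ P₁ := Injective.factorThru i₁ (e.hom ≫ i₂)
    have hff : i₁ ≫ f ≫ f' = i₁ := by simp [f, f', ← Category.assoc]
    refine ⟨f, f', fun ⟨m, hm⟩ => hi₁ ?_⟩
    have key : ∀ (m : ℕ) (x : T₁), ((f'.hom ∘ₗ f.hom : Module.End Λ P₁) ^ m) (i₁.hom x) =
        i₁.hom x := by
      intro m
      induction m with
      | zero => intro x; rfl
      | succ m ih =>
        intro x
        rw [pow_succ', Module.End.mul_apply, ih]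
        exact congr(($hff).hom x)
    ext x
    rw [← key m x, hm]
    rfl
  · refine (hi₁ ?_).elim
    rw [← Category.id_comp i₁, ← e.hom_inv_id, Category.assoc, ht₂ P₁ hP₁ (e.inv ≫ i₁),
      Limits.comp_zero]
  · refine (hi₂ ?_).elim
    rw [← Category.id_comp i₂, ← e.inv_hom_id, Category.assoc, ht₁ P₂ hP₂ (e.hom ≫ i₂),
      Limits.comp_zero]
  · have := mono_of_isSimpleModule hi₁
    have := mono_of_isSimpleModule hi₂
    exact CosyzygySocleRel.not_nilpotent ht₁ hc₁ hc₂ hC₁ hC₂ i₁ (e.hom ≫ i₂) hi₁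

/-- Every simple module embeds in an injective module `C` such that all homomorphisms to `C` from
modules without extensions of degree `n + 1` by `Λ` factor through projective-injective modules. -/
theorem exists_injective_of_simple [IsArtinianRing Λ] {n : ℕ} {C₀ : ModuleCat.{u} Λ}
    (hdom : PrinjCosyzygy (n + 1) (ModuleCat.of Λ Λ) C₀)
    (hid : HasInjectiveDimensionLT (ModuleCat.of Λ Λ) (n + 2))
    (T : ModuleCat.{u} Λ) (hT : IsSimpleModule Λ T) :
    ∃ C : ModuleCat.{u} Λ, Injective C ∧ (∃ i : T ⟶ C, i ≠ 0) ∧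
      ∀ D : ModuleCat.{u} Λ, (∀ z : Ext D (ModuleCat.of Λ Λ) (n + 1), z = 0) →
        ∀ e : D ⟶ C, FactorsThroughPrinj e := by
  have := finite_simpleSetoid (Λ := Λ)
  obtain ⟨S, T', hr, ⟨e⟩⟩ := exists_of_total_relation (simpleSetoid Λ)
    (fun S T => CosyzygySocleRel n S.1 T.1)
    (fun S => by
      obtain ⟨T, hT, h⟩ := CosyzygySocleRel.total hdom hid S.1 S.2
      exact ⟨⟨T, hT⟩, h⟩)
    (fun S₁ S₂ T₁ T₂ h₁ h₂ ⟨e⟩ =>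
      CosyzygySocleRel.injective S₁.2 S₂.2 T₁.2 T₂.2 h₁ h₂ e.toModuleIso) ⟨T, hT⟩
  have hne : ∀ {X : ModuleCat.{u} Λ} {i : T'.1 ⟶ X}, i ≠ 0 → e.toModuleIso.inv ≫ i ≠ 0 := by
    intro X i hi h0
    refine hi ?_
    rw [← Category.id_comp i, ← e.toModuleIso.hom_inv_id, Category.assoc]
    exact (congrArg (e.toModuleIso.hom ≫ ·) h0).trans Limits.comp_zero
  obtain ⟨P, ⟨r⟩, -, -, ⟨hP, i, hi⟩ | ⟨-, C, hC, hc, i, hi⟩⟩ := hr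
  · exact ⟨P, hP.injective, ⟨_, hne hi⟩, fun D _ f => ⟨P, hP, f, 𝟙 P, Category.comp_id f⟩⟩
  · exact ⟨C, hC, ⟨_, hne hi⟩, fun D hD f => hc.factorsThroughPrinj (ext_eq_zero_of_retract r hD) f⟩

end SimpleModules

/-! ### Dimension shifting -/

section ExtShift

variable {Λ : Type u} [Ring Λ]

theorem exists_shortExact {A B C : Type u} [AddCommGroup A] [Module Λ A] [AddCommGroup B]
    [Module Λ B] [AddCommGroup C] [Module Λ C] (f : A →ₗ[Λ] B) (g : B →ₗ[Λ] C)
    (hf : Function.Injective f) (hfg : Function.Exact f g) (hg : Function.Surjective g) :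
    ∃ w : ModuleCat.ofHom f ≫ ModuleCat.ofHom g = 0,
      (ShortComplex.mk (ModuleCat.ofHom f) (ModuleCat.ofHom g) w).ShortExact :=
  ⟨by ext x; exact hfg.apply_apply_eq_zero x,
    ModuleCat.shortComplex_shortExact _ hfg hf hg⟩

variable {S : ShortComplex (ModuleCat.{u} Λ)} {Y : ModuleCat.{u} Λ}

theorem ext_X₃_eq_zero (hS : S.ShortExact) {i : ℕ} (h₁ : ∀ z : Ext S.X₁ Y i, z = 0)
    (h₂ : ∀ z : Ext S.X₂ Y (i + 1), z = 0) (z : Ext S.X₃ Y (i + 1)) : z = 0 := by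
  obtain ⟨x, rfl⟩ := Ext.contravariant_sequence_exact₃ hS Y z (h₂ _) (add_comm 1 i)
  rw [h₁ x, Ext.comp_zero]

theorem ext_X₁_eq_zero (hS : S.ShortExact) {i : ℕ} (h₃ : ∀ z : Ext S.X₃ Y (i + 1), z = 0)
    (h₂ : ∀ z : Ext S.X₂ Y i, z = 0) (z : Ext S.X₁ Y i) : z = 0 := by
  obtain ⟨x, rfl⟩ := Ext.contravariant_sequence_exact₁ hS Y z (add_comm 1 i) (h₃ _)
  rw [h₂ x, Ext.comp_zero]

theorem exists_extension_of_ext_eq_zero (hS : S.ShortExact) (h₃ : ∀ z : Ext S.X₃ Y 1, z = 0)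
    (f : S.X₁ ⟶ Y) : ∃ g : S.X₂ ⟶ Y, S.f ≫ g = f := by
  obtain ⟨x, hx⟩ := Ext.contravariant_sequence_exact₁ hS Y (Ext.mk₀ f) (add_zero 1) (h₃ _)
  obtain ⟨g, rfl⟩ := (Ext.mk₀_bijective _ _).2 x
  rw [Ext.mk₀_comp_mk₀] at hx
  exact ⟨g, (Ext.mk₀_bijective _ _).1 hx⟩

theorem ext_one_eq_zero_of_extension (hS : S.ShortExact) (hP : Projective S.X₂)
    (h : ∀ f : S.X₁ ⟶ Y, ∃ g : S.X₂ ⟶ Y, S.f ≫ g = f) (z : Ext S.X₃ Y 1) : z = 0 := by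
  obtain ⟨x, rfl⟩ := Ext.contravariant_sequence_exact₃ hS Y z
    (Ext.eq_zero_of_projective (P := S.X₂) _) (add_zero 1)
  obtain ⟨f, rfl⟩ := (Ext.mk₀_bijective _ _).2 x
  obtain ⟨g, rfl⟩ := h f
  rw [← Ext.mk₀_comp_mk₀, ← Ext.comp_assoc (h₁₂ := add_zero 1) (h := by omega), hS.extClass_comp,
    Ext.zero_comp]

end ExtShift

/-! ### Gorenstein projectives: Ext vanishing and construction by splicing -/

section GorensteinProjective

variable {Λ : Type u} [Ring Λ]

/-- The differential of a totally acyclic complex, with values in the cocycles. -/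
def TotallyAcyclicComplex.toCocycles (P : TotallyAcyclicComplex Λ) (i : ℤ) :
    P.term i →ₗ[Λ] LinearMap.ker (P.d (i + 1)) :=
  (P.d i).codRestrict _ fun x => LinearMap.mem_ker.2 ((P.exact i).apply_apply_eq_zero x)

theorem TotallyAcyclicComplex.toCocycles_surjective (P : TotallyAcyclicComplex Λ) (i : ℤ) :
    Function.Surjective (P.toCocycles i) := fun x => by
  obtain ⟨y, hy⟩ := (P.exact i x.1).1 x.2
  exact ⟨y, Subtype.ext hy⟩

theorem TotallyAcyclicComplex.shortExact (P : TotallyAcyclicComplex Λ) (i : ℤ) :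
    ∃ w : ModuleCat.ofHom (LinearMap.ker (P.d i)).subtype ≫ ModuleCat.ofHom (P.toCocycles i) = 0,
      (ShortComplex.mk _ _ w).ShortExact :=
  exists_shortExact _ _ (Submodule.injective_subtype _)
    (by rw [LinearMap.exact_iff, toCocycles, LinearMap.ker_codRestrict, Submodule.range_subtype])
    (P.toCocycles_surjective i)

theorem TotallyAcyclicComplex.projective_term (P : TotallyAcyclicComplex Λ) (i : ℤ) :
    Projective (ModuleCat.of Λ (P.term i)) :=
  (IsProjective.iff_projective _).1 (P.projective i)

theorem TotallyAcyclicComplex.ext_one_eq_zero (P : TotallyAcyclicComplex Λ) (i : ℤ)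
    (z : Ext (ModuleCat.of Λ (LinearMap.ker (P.d (i + 1 + 1 + 1)))) (ModuleCat.of Λ Λ) 1) :
    z = 0 := by
  obtain ⟨w, h⟩ := P.shortExact (i + 1 + 1)
  refine ext_one_eq_zero_of_extension h (P.projective_term (i + 1 + 1)) (fun f => ?_) z
  -- A functional on the cocycles in degree i + 2, composed with the surjection from degree i + 1,
  -- kills boundaries; exactness under Hom(-, Λ) extends it.
  obtain ⟨g, hg⟩ := P.hom_exact i (f.hom ∘ₗ P.toCocycles (i + 1)) (by
    ext x
    have h0 : P.toCocycles (i + 1) (P.d i x) = 0 :=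
      Subtype.ext ((P.exact i).apply_apply_eq_zero x)
    simp only [LinearMap.comp_apply, h0, map_zero, LinearMap.zero_apply])
  refine ⟨ModuleCat.ofHom g, ?_⟩
  ext x
  obtain ⟨y, rfl⟩ := P.toCocycles_surjective (i + 1) x
  exact congr($hg y)

theorem TotallyAcyclicComplex.ext_eq_zero (P : TotallyAcyclicComplex Λ) (k : ℕ) : ∀ (i : ℤ)
    (z : Ext (ModuleCat.of Λ (LinearMap.ker (P.d i))) (ModuleCat.of Λ Λ) (k + 1)), z = 0 := by
  induction k with
  | zero =>
    intro i
    obtain ⟨j, rfl⟩ : ∃ j : ℤ, i = j + 1 + 1 + 1 := ⟨i - 3, by omega⟩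
    exact P.ext_one_eq_zero j
  | succ k ih =>
    intro i
    obtain ⟨j, rfl⟩ : ∃ j : ℤ, i = j + 1 := ⟨i - 1, by omega⟩
    obtain ⟨w, h⟩ := P.shortExact j
    have := P.projective_term j
    exact ext_X₃_eq_zero h (ih j) fun z => Ext.eq_zero_of_projective (P := ModuleCat.of Λ _) z

theorem IsGorensteinProjective.ext_eq_zero {M : Type u} [AddCommGroup M] [Module Λ M]
    (hM : IsGorensteinProjective Λ M) (k : ℕ)
    (z : Ext (ModuleCat.of Λ M) (ModuleCat.of Λ Λ) (k + 1)) : z = 0 := by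
  obtain ⟨P, ⟨e⟩⟩ := hM
  exact ext_eq_zero_of_retract_left
    ⟨e.toModuleIso.hom, e.toModuleIso.inv, e.toModuleIso.hom_inv_id⟩ (P.ext_eq_zero k 0) z

theorem HasGorensteinProjectiveResolution.ext_eq_zero (n : ℕ) (M : Type u) [AddCommGroup M]
    [Module Λ M] (hM : HasGorensteinProjectiveResolution Λ n M) (k : ℕ) (hk : n ≤ k)
    (z : Ext (ModuleCat.of Λ M) (ModuleCat.of Λ Λ) (k + 1)) : z = 0 := by
  induction n generalizing M k with
  | zero => exact IsGorensteinProjective.ext_eq_zero hM k z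
  | succ n ih =>
    obtain ⟨K, G, i, p, hi, hip, hp, hG, hK⟩ := hM
    obtain ⟨w, h⟩ := exists_shortExact i p hi hip hp
    obtain ⟨k, rfl⟩ : ∃ l, k = l + 1 := ⟨k - 1, by omega⟩
    exact ext_X₃_eq_zero h (fun z => ih K hK k (by omega) z) (fun z => hG.ext_eq_zero _ z) z

/-- Short exact sequences `0 → X → T → Y → 0` with `T` finitely generated projective that stay
exact under `Hom_Λ(-, Λ)`. -/
def IsHomExactExtension (X Y : ModuleCat.{u} Λ) : Prop :=
  ∃ (T : ModuleCat.{u} Λ) (f : X →ₗ[Λ] T) (g : T →ₗ[Λ] Y), Module.Finite Λ T ∧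
    Module.Projective Λ T ∧ Function.Injective f ∧ Function.Exact f g ∧ Function.Surjective g ∧
      ∀ h : X →ₗ[Λ] Λ, ∃ h' : T →ₗ[Λ] Λ, h' ∘ₗ f = h

theorem isGorensteinProjective_of_sequence (Z : ℤ → ModuleCat.{u} Λ)
    (hZ : ∀ i, IsHomExactExtension (Z i) (Z (i + 1))) : IsGorensteinProjective Λ (Z 0) := by
  choose T f g hfin hproj hf hfg hg hext using hZ
  have hk : ∀ i, LinearMap.ker (f (i + 1) ∘ₗ g i) = LinearMap.range (f i) := fun i => by
    rw [LinearMap.ker_comp_of_ker_eq_bot _ (LinearMap.ker_eq_bot.2 (hf _)),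
      LinearMap.exact_iff.1 (hfg i)]
  refine ⟨⟨T, fun i => f (i + 1) ∘ₗ g i, hfin, hproj, fun i => ?_, fun i q hq => ?_⟩,
    ⟨(LinearEquiv.ofInjective (f 0) (hf 0)).trans (LinearEquiv.ofEq _ _ (hk 0).symm)⟩⟩
  · rw [LinearMap.exact_iff, hk, LinearMap.range_comp_of_range_eq_top _
      (LinearMap.range_eq_top.2 (hg i))]
  · have hle : LinearMap.ker (g (i + 1)) ≤ LinearMap.ker q := by
      rw [LinearMap.exact_iff.1 (hfg (i + 1))]
      rintro _ ⟨x, rfl⟩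
      obtain ⟨y, rfl⟩ := hg i x
      exact congr($hq y)
    let q' : Z (i + 1 + 1) →ₗ[Λ] Λ := (LinearMap.ker (g (i + 1))).liftQ q hle ∘ₗ
      ((g (i + 1)).quotKerEquivOfSurjective (hg (i + 1))).symm.toLinearMap
    have hq' : ∀ x, q' (g (i + 1) x) = q x := fun x => by
      have : ((g (i + 1)).quotKerEquivOfSurjective (hg (i + 1))).symm (g (i + 1) x) =
          Submodule.Quotient.mk x := by
        rw [LinearEquiv.symm_apply_eq]
        rfl
      simp [q', this]
    obtain ⟨h', hh'⟩ := hext (i + 1 + 1) q'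
    refine ⟨h', LinearMap.ext fun x => ?_⟩
    rw [← hq' x, ← hh']
    rfl

/-- A class of modules closed under syzygies and cosyzygies consists of Gorenstein projectives. -/
theorem isGorensteinProjective_of_closed (W : ModuleCat.{u} Λ → Prop)
    (hl : ∀ X, W X → ∃ Y, W Y ∧ IsHomExactExtension Y X)
    (hr : ∀ X, W X → ∃ Y, W Y ∧ IsHomExactExtension X Y) (X : ModuleCat.{u} Λ) (hX : W X) :
    IsGorensteinProjective Λ X := by
  choose L hLW hL using hl
  choose R hRW hR using hr
  let l : ℕ → {X // W X} := fun n => Nat.rec ⟨X, hX⟩ (fun _ Y => ⟨L Y.1 Y.2, hLW Y.1 Y.2⟩) n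
  let r : ℕ → {X // W X} := fun n => Nat.rec ⟨X, hX⟩ (fun _ Y => ⟨R Y.1 Y.2, hRW Y.1 Y.2⟩) n
  -- `Int.negSucc n` is -(n + 1), hence `l (n + 1)`; both halves start at X, which sits in degree 0.
  let Z : ℤ → ModuleCat.{u} Λ := fun i =>
    match i with
    | Int.ofNat n => (r n).1
    | Int.negSucc n => (l (n + 1)).1
  refine isGorensteinProjective_of_sequence Z fun i => ?_
  match i with
  | Int.ofNat n => exact hR (r n).1 (r n).2
  | Int.negSucc 0 => exact hL (l 0).1 (l 0).2
  | Int.negSucc (n + 1) => exact hL (l (n + 1)).1 (l (n + 1)).2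

end GorensteinProjective

/-! ### Cosyzygies of Λ from the dominant dimension -/

section DominantDimension

variable {Λ : Type u} [Ring Λ]

theorem MinimalInjectiveCoresolution.exists_prinjCosyzygy_range {M : Type u} [AddCommGroup M]
    [Module Λ M] (I : MinimalInjectiveCoresolution Λ M) (k : ℕ) : ∀ j : ℕ,
    (∀ l, j < l → l ≤ j + k → Module.Projective Λ (I.term l)) →
      ∃ C, PrinjCosyzygy k (ModuleCat.of Λ (LinearMap.range (I.d j))) C := by
  induction k with
  | zero => exact fun j _ => ⟨_, .refl _⟩
  | succ k ih =>
    intro j h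
    obtain ⟨C, hC⟩ := ih (j + 1) fun l hl hl' => h l (by omega) (by omega)
    obtain ⟨w, hS⟩ := exists_shortExact (LinearMap.range (I.d j)).subtype
      (I.d (j + 1)).rangeRestrict (Submodule.injective_subtype _)
      (by rw [LinearMap.exact_iff, LinearMap.ker_rangeRestrict, Submodule.range_subtype,
        LinearMap.exact_iff.1 (I.exact_succ j)])
      (I.d (j + 1)).surjective_rangeRestrict
    exact ⟨C, .step hS ⟨I.finite _, h _ (by omega) (by omega), I.injective _⟩ hC⟩

theorem MinimalInjectiveCoresolution.exists_prinjCosyzygy {M : Type u} [AddCommGroup M]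
    [Module Λ M] (I : MinimalInjectiveCoresolution Λ M) (k : ℕ)
    (h : ∀ l ≤ k, Module.Projective Λ (I.term l)) :
    ∃ C, PrinjCosyzygy (k + 1) (ModuleCat.of Λ M) C := by
  obtain ⟨C, hC⟩ := I.exists_prinjCosyzygy_range k 0 fun l _ hl => h l (by omega)
  obtain ⟨w, hS⟩ := exists_shortExact I.aug (I.d 0).rangeRestrict I.aug_injective
    (by rw [LinearMap.exact_iff, LinearMap.ker_rangeRestrict, LinearMap.exact_iff.1 I.exact_zero])
    (I.d 0).surjective_rangeRestrict
  exact ⟨C, .step hS ⟨I.finite _, h _ (by omega), I.injective _⟩ hC⟩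

theorem exists_prinjCosyzygy_of_le_dominantDimension {n : ℕ}
    (h : ((n + 1 : ℕ) : ℕ∞) ≤ dominantDimension Λ) :
    ∃ C, PrinjCosyzygy (n + 1) (ModuleCat.of Λ Λ) C := by
  by_contra hno
  have hle : dominantDimension Λ ≤ n := by
    refine sSup_le ?_
    rintro _ ⟨m, rfl, I, hI⟩
    by_contra hm
    have hm' : n < m := by exact_mod_cast not_le.1 hm
    exact hno (I.exists_prinjCosyzygy n fun l hl => hI l (by omega))
  have : n + 1 ≤ n := by exact_mod_cast h.trans hle
  omega

theorem IsMinimalAuslanderGorenstein.hasInjectiveDimensionLT {n : ℕ}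
    (h : IsMinimalAuslanderGorenstein Λ n) :
    HasInjectiveDimensionLT (ModuleCat.of Λ Λ) (n + 2) :=
  (injectiveDimension_le_iff _ _).1 h.1

end DominantDimension

/-! ### Ext-orthogonal modules are Gorenstein projective -/

section Approximation

variable {Λ : Type u} [Ring Λ]

/-- Every homomorphism from a finitely generated module over an Artin algebra to the algebra
factors through a single homomorphism to a finitely generated free module. -/
theorem exists_left_approximation (R : Type v) [CommRing R] [IsNoetherianRing R] [Algebra R Λ]
    [Module.Finite R Λ] (X : Type u) [AddCommGroup X] [Module Λ X] [Module.Finite Λ X] :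
    ∃ (m : ℕ) (f : X →ₗ[Λ] (Fin m → Λ)), ∀ h : X →ₗ[Λ] Λ, ∃ h' : (Fin m → Λ) →ₗ[Λ] Λ,
      h' ∘ₗ f = h := by
  obtain ⟨k, p, hp⟩ := Module.Finite.exists_fin' Λ X
  -- Evaluation on generators embeds the dual of X in a finite R-module, so finitely many
  -- functionals span it over R; these are the components of the approximation.
  let ev : (X →ₗ[Λ] Λ) →ₗ[R] (Fin k → Λ) :=
    { toFun := fun h i => h (p (Pi.single i 1))
      map_add' := fun _ _ => rfl
      map_smul' := fun _ _ => rfl }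
  have hev : Function.Injective ev := by
    intro g h hgh
    have : g ∘ₗ p = h ∘ₗ p := by
      refine LinearMap.pi_ext' fun i => LinearMap.ext_ring ?_
      exact congr($hgh i)
    ext x
    obtain ⟨y, rfl⟩ := hp x
    exact congr($this y)
  have : Module.Finite R (X →ₗ[Λ] Λ) := Module.Finite.of_injective ev hev
  obtain ⟨m, q, hq⟩ := Module.Finite.exists_fin' R (X →ₗ[Λ] Λ)
  refine ⟨m, LinearMap.pi fun i => q (Pi.single i 1), fun h => ?_⟩
  obtain ⟨c, rfl⟩ := hq h
  refine ⟨∑ i, c i • LinearMap.proj i, LinearMap.ext fun x => ?_⟩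
  have hc : q c = ∑ i, c i • q (Pi.single i 1) := by
    conv_lhs => rw [pi_eq_sum_univ' c, map_sum]
    simp
  rw [hc]
  simp [LinearMap.sum_apply]

theorem exists_dual_ne_zero {Q : Type u} [AddCommGroup Q] [Module Λ Q] [Module.Projective Λ Q]
    {q : Q} (hq : q ≠ 0) : ∃ h : Q →ₗ[Λ] Λ, h q ≠ 0 := by
  obtain ⟨s, hs⟩ := Module.Projective.out (R := Λ) (P := Q)
  have hsq : s q ≠ 0 := fun h0 => hq (by rw [← hs q, h0, map_zero])
  obtain ⟨c, hc⟩ := Finsupp.ne_iff.1 hsq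
  exact ⟨Finsupp.lapply c ∘ₗ s, hc⟩

/-- Finitely generated modules without extensions of positive degree by `Λ`. -/
def IsExtOrthogonal (X : ModuleCat.{u} Λ) : Prop :=
  Module.Finite Λ X ∧ ∀ (k : ℕ) (z : Ext X (ModuleCat.of Λ Λ) (k + 1)), z = 0

theorem exists_free_cover [IsNoetherianRing Λ] (X : ModuleCat.{u} Λ) (hX : Module.Finite Λ X) :
    ∃ S : ShortComplex (ModuleCat.{u} Λ), S.ShortExact ∧ S.X₃ = X ∧ Module.Finite Λ S.X₁ ∧
      Module.Finite Λ S.X₂ ∧ Projective S.X₂ := by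
  obtain ⟨k, p, hp⟩ := Module.Finite.exists_fin' Λ X
  refine ⟨p.shortComplexKer, LinearMap.shortExact_shortComplexKer hp, rfl,
    inferInstanceAs (Module.Finite Λ (LinearMap.ker p)),
    inferInstanceAs (Module.Finite Λ (Fin k → Λ)), ?_⟩
  exact (IsProjective.iff_projective (Fin k → Λ)).1 inferInstance

theorem IsHomExactExtension.of_shortExact {S : ShortComplex (ModuleCat.{u} Λ)} (hS : S.ShortExact)
    (h₂ : Module.Finite Λ S.X₂) (hP : Projective S.X₂)
    (h : ∀ f : S.X₁ ⟶ ModuleCat.of Λ Λ, ∃ g : S.X₂ ⟶ ModuleCat.of Λ Λ, S.f ≫ g = f) :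
    IsHomExactExtension S.X₁ S.X₃ := by
  refine ⟨S.X₂, S.f.hom, S.g.hom, h₂, (IsProjective.iff_projective S.X₂).2 hP,
    hS.moduleCat_injective_f, ?_, hS.moduleCat_surjective_g, fun q => ?_⟩
  · exact (ShortComplex.ShortExact.moduleCat_exact_iff_function_exact S).1 hS.exact
  · obtain ⟨g, hg⟩ := h (ModuleCat.ofHom q)
    exact ⟨g.hom, congr(($hg).hom)⟩

theorem IsExtOrthogonal.exists_syzygy [IsNoetherianRing Λ] {X : ModuleCat.{u} Λ}
    (hX : IsExtOrthogonal X) : ∃ Y, IsExtOrthogonal Y ∧ IsHomExactExtension Y X := by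
  obtain ⟨S, hS, rfl, h₁, h₂, hP⟩ := exists_free_cover X hX.1
  refine ⟨S.X₁, ⟨h₁, fun k => ext_X₁_eq_zero hS (hX.2 (k + 1)) fun z =>
    Ext.eq_zero_of_projective z⟩, .of_shortExact hS h₂ hP ?_⟩
  exact exists_extension_of_ext_eq_zero hS (hX.2 0)

variable {n : ℕ} {C₀ : ModuleCat.{u} Λ}

/-- A simple S in the kernel embeds in the C of `exists_injective_of_simple`. The extension X → C
factors through a projective Q, whose points are separated by functionals; these factor through f on
X, so S dies in Q. -/
theorem IsExtOrthogonal.injective_approximation [IsArtinianRing Λ]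
    (hdom : PrinjCosyzygy (n + 1) (ModuleCat.of Λ Λ) C₀)
    (hid : HasInjectiveDimensionLT (ModuleCat.of Λ Λ) (n + 2)) {X : ModuleCat.{u} Λ}
    (hX : IsExtOrthogonal X) {T : Type u} [AddCommGroup T] [Module Λ T] (f : X →ₗ[Λ] T)
    (hf : ∀ h : X →ₗ[Λ] Λ, ∃ h' : T →ₗ[Λ] Λ, h' ∘ₗ f = h) : Function.Injective f := by
  rw [← LinearMap.ker_eq_bot]
  by_contra hne
  have := hX.1
  obtain ⟨S, hS, hle⟩ := exists_simple_submodule_le hne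
  obtain ⟨C, hC, ⟨i, hi⟩, hfac⟩ := exists_injective_of_simple hdom hid (ModuleCat.of Λ S) hS
  have hmono : Mono (ModuleCat.ofHom S.subtype) :=
    (ModuleCat.mono_iff_injective _).2 S.injective_subtype
  obtain ⟨Q, hQ, a, b, hab⟩ := hfac X (hX.2 n) (Injective.factorThru i (ModuleCat.ofHom S.subtype))
  refine hi ?_
  rw [← Injective.comp_factorThru i (ModuleCat.ofHom S.subtype), ← hab]
  ext x
  have ha : a.hom (x : X) = 0 := by
    by_contra ha
    have := hQ.2.1
    obtain ⟨h, hh⟩ := exists_dual_ne_zero (Λ := Λ) ha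
    obtain ⟨h', hh'⟩ := hf (h ∘ₗ a.hom)
    refine hh ?_
    have hx : f x = 0 := hle x.2
    have := congr($hh' (x : X))
    rw [LinearMap.comp_apply, hx, map_zero] at this
    exact this.symm
  have : b.hom (a.hom (x : X)) = 0 := by rw [ha, map_zero]
  exact this

theorem IsExtOrthogonal.exists_cosyzygy [IsArtinianRing Λ] (R : Type v) [CommRing R]
    [IsNoetherianRing R] [Algebra R Λ] [Module.Finite R Λ]
    (hdom : PrinjCosyzygy (n + 1) (ModuleCat.of Λ Λ) C₀)
    (hid : HasInjectiveDimensionLT (ModuleCat.of Λ Λ) (n + 2)) {X : ModuleCat.{u} Λ}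
    (hX : IsExtOrthogonal X) : ∃ Y, IsExtOrthogonal Y ∧ IsHomExactExtension X Y := by
  have := hX.1
  obtain ⟨m, f, hf⟩ := exists_left_approximation R X (Λ := Λ)
  obtain ⟨w, hS⟩ := exists_shortExact f (LinearMap.range f).mkQ
    (hX.injective_approximation hdom hid f hf)
    (by rw [LinearMap.exact_iff, Submodule.ker_mkQ]) (Submodule.mkQ_surjective _)
  have hP : Projective (ModuleCat.of Λ (Fin m → Λ)) :=
    (IsProjective.iff_projective (Fin m → Λ)).1 inferInstance
  have hext : ∀ g : X ⟶ ModuleCat.of Λ Λ, ∃ g' : ModuleCat.of Λ (Fin m → Λ) ⟶ ModuleCat.of Λ Λ,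
      ModuleCat.ofHom f ≫ g' = g := fun g => by
    obtain ⟨h', hh'⟩ := hf g.hom
    exact ⟨ModuleCat.ofHom h', ModuleCat.hom_ext hh'⟩
  refine ⟨_, ⟨inferInstanceAs (Module.Finite Λ ((Fin m → Λ) ⧸ LinearMap.range f)), fun k => ?_⟩,
    .of_shortExact hS (inferInstanceAs (Module.Finite Λ (Fin m → Λ))) hP hext⟩
  cases k with
  | zero => exact ext_one_eq_zero_of_extension hS hP hext
  | succ k => exact ext_X₃_eq_zero hS (hX.2 k) fun z => Ext.eq_zero_of_projective z

theorem IsExtOrthogonal.isGorensteinProjective [IsArtinianRing Λ] (R : Type v) [CommRing R]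
    [IsNoetherianRing R] [Algebra R Λ] [Module.Finite R Λ]
    (hdom : PrinjCosyzygy (n + 1) (ModuleCat.of Λ Λ) C₀)
    (hid : HasInjectiveDimensionLT (ModuleCat.of Λ Λ) (n + 2)) {X : ModuleCat.{u} Λ}
    (hX : IsExtOrthogonal X) : IsGorensteinProjective Λ X :=
  isGorensteinProjective_of_closed IsExtOrthogonal (fun _ h => h.exists_syzygy)
    (fun _ h => h.exists_cosyzygy R hdom hid) X hX

theorem hasGorensteinProjectiveResolution_of_ext_eq_zero [IsArtinianRing Λ] (R : Type v) [CommRing R]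
    [IsNoetherianRing R] [Algebra R Λ] [Module.Finite R Λ]
    (hdom : PrinjCosyzygy (n + 1) (ModuleCat.of Λ Λ) C₀)
    (hid : HasInjectiveDimensionLT (ModuleCat.of Λ Λ) (n + 2)) (m : ℕ) (X : ModuleCat.{u} Λ)
    (hX : Module.Finite Λ X)
    (h : ∀ k, m ≤ k → ∀ z : Ext X (ModuleCat.of Λ Λ) (k + 1), z = 0) :
    HasGorensteinProjectiveResolution Λ m X := by
  induction m generalizing X with
  | zero =>
    have hX' : IsExtOrthogonal X := ⟨hX, fun k => h k k.zero_le⟩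
    exact hX'.isGorensteinProjective R hdom hid
  | succ m ih =>
    obtain ⟨S, hS, rfl, h₁, h₂, hP⟩ := exists_free_cover X hX
    have hG : IsExtOrthogonal S.X₂ := ⟨h₂, fun k z => Ext.eq_zero_of_projective z⟩
    refine ⟨S.X₁, S.X₂, S.f.hom, S.g.hom, hS.moduleCat_injective_f, ?_,
      hS.moduleCat_surjective_g, hG.isGorensteinProjective R hdom hid, ih S.X₁ h₁ ?_⟩
    · exact (ShortComplex.ShortExact.moduleCat_exact_iff_function_exact S).1 hS.exact
    · exact fun k hk => ext_X₁_eq_zero hS (h (k + 1) (by omega)) fun z =>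
        Ext.eq_zero_of_projective z

theorem ext_eq_zero_of_submodule_prinj
    (hdom : PrinjCosyzygy (n + 1) (ModuleCat.of Λ Λ) C₀)
    (hid : HasInjectiveDimensionLT (ModuleCat.of Λ Λ) (n + 2)) {M I : ModuleCat.{u} Λ}
    (hI : Projective I) (i : M ⟶ I) [Mono i] (k : ℕ) (hk : n ≤ k)
    (z : Ext M (ModuleCat.of Λ Λ) (k + 1)) : z = 0 := by
  obtain rfl | hlt := hk.eq_or_lt
  · exact hdom.ext_eq_zero (hdom.injective hid) hI i z
  · exact z.eq_zero_of_hasInjectiveDimensionLT (n + 2) (by omega)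

end Approximation

/-! ### Socles and the Gorenstein projective dimension -/

section Socle

variable {Λ : Type u} [Ring Λ]

theorem le_socle {M : Type u} [AddCommGroup M] [Module Λ M] (S : Submodule Λ M)
    (hS : IsSimpleModule Λ S) : S ≤ socle Λ M :=
  le_sSup hS

theorem isSemisimpleModule_socle (M : Type u) [AddCommGroup M] [Module Λ M] :
    IsSemisimpleModule Λ (socle Λ M) := by
  rw [socle, sSup_eq_iSup]
  exact isSemisimpleModule_biSup_of_isSemisimpleModule_submodule fun S (hS : IsSimpleModule Λ S) =>
    inferInstance

theorem nonempty_retract_socle {M : Type u} [AddCommGroup M] [Module Λ M] (S : Submodule Λ M)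
    (hS : IsSimpleModule Λ S) :
    Nonempty (Retract (ModuleCat.of Λ S) (ModuleCat.of Λ (socle Λ M))) := by
  have := isSemisimpleModule_socle (Λ := Λ) M
  obtain ⟨r, hr⟩ := IsSemisimpleModule.extension_property
    (Submodule.inclusion (le_socle S hS)) (Submodule.inclusion_injective _) LinearMap.id
  exact ⟨⟨ModuleCat.ofHom (Submodule.inclusion (le_socle S hS)), ModuleCat.ofHom r,
    ModuleCat.hom_ext hr⟩⟩

theorem Gpd_le_iff {M : Type u} [AddCommGroup M] [Module Λ M] (n : ℕ) :
    Gpd Λ M ≤ n ↔ ∃ m ≤ n, HasGorensteinProjectiveResolution Λ m M := by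
  constructor
  · intro h
    by_contra hno
    have hle : ((n + 1 : ℕ) : ℕ∞) ≤ Gpd Λ M := by
      refine le_sInf ?_
      rintro _ ⟨m, rfl, hm⟩
      by_contra hlt
      have hlt' : m < n + 1 := by exact_mod_cast not_le.1 hlt
      exact hno ⟨m, by omega, hm⟩
    have : n + 1 ≤ n := by exact_mod_cast hle.trans h
    omega
  · rintro ⟨m, hm, h⟩
    exact (sInf_le ⟨m, rfl, h⟩ : Gpd Λ M ≤ m).trans (by exact_mod_cast hm)

theorem projective_of_ext_socle_eq_zero [IsArtinianRing Λ] {n : ℕ} {C₀ : ModuleCat.{u} Λ}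
    (hdom : PrinjCosyzygy (n + 1) (ModuleCat.of Λ Λ) C₀)
    (hid : HasInjectiveDimensionLT (ModuleCat.of Λ Λ) (n + 2)) (I : Type u) [AddCommGroup I]
    [Module Λ I] [Module.Finite Λ I] [Module.Injective Λ I]
    (h : ∀ z : Ext (ModuleCat.of Λ (socle Λ I)) (ModuleCat.of Λ Λ) (n + 1), z = 0) :
    Module.Projective Λ I := by
  obtain ⟨Q, hQ, f, hf⟩ := exists_mono_prinj (ModuleCat.of Λ I) fun S hS hT => by
    obtain ⟨C, hC, ⟨i, hi⟩, hfac⟩ := exists_injective_of_simple hdom hid (ModuleCat.of Λ S) hS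
    obtain ⟨r⟩ := nonempty_retract_socle S hS
    obtain ⟨J, hJ, a, b, rfl⟩ := hfac _ (ext_eq_zero_of_retract_left r h) i
    -- The embedding of S factors through a projective-injective J, to which a torsion S has no
    -- nonzero map.
    exact hi (by rw [hT J hJ a, Limits.zero_comp])
  have : Injective (ModuleCat.of Λ I) := Module.injective_object_of_injective_module Λ I
  exact (prinj_of_retract ⟨f, Injective.factorThru (𝟙 _) f, Injective.comp_factorThru _ _⟩ hQ).2.1

end Socle

theorem theorem3p2 (R : Type v) [CommRing R] [IsArtinianRing R]
    (Λ : Type u) [Ring Λ] [Algebra R Λ] [Module.Finite R Λ]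
    (n : ℕ) (hΛ : IsMinimalAuslanderGorenstein Λ n) :
    (∀ (I : Type u) [AddCommGroup I] [Module Λ I], Module.Finite Λ I → Module.Injective Λ I →
        (Module.Projective Λ I ↔ Gpd Λ (socle Λ I) ≤ n)) ∧
      prinj Λ = fun I : ModuleCat.{u} Λ =>
        Module.Finite Λ I ∧ Module.Injective Λ I ∧ Gpd Λ (socle Λ I) ≤ n := by
  have : IsArtinianRing Λ := IsArtinianRing.of_finite R Λ
  obtain ⟨C₀, hdom⟩ := exists_prinjCosyzygy_of_le_dominantDimension hΛ.2
  have hid := hΛ.hasInjectiveDimensionLT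
  have main : ∀ (I : Type u) [AddCommGroup I] [Module Λ I], Module.Finite Λ I →
      Module.Injective Λ I → (Module.Projective Λ I ↔ Gpd Λ (socle Λ I) ≤ n) := by
    intro I _ _ hfin hinj
    rw [Gpd_le_iff]
    constructor
    · intro hproj
      have hmono : Mono (ModuleCat.ofHom (socle Λ I).subtype) :=
        (ModuleCat.mono_iff_injective _).2 (Submodule.injective_subtype _)
      exact ⟨n, le_rfl, hasGorensteinProjectiveResolution_of_ext_eq_zero R hdom hid n
        (ModuleCat.of Λ (socle Λ I)) (inferInstanceAs (Module.Finite Λ (socle Λ I)))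
        fun k hk => ext_eq_zero_of_submodule_prinj hdom hid
          ((IsProjective.iff_projective I).1 hproj) (ModuleCat.ofHom (socle Λ I).subtype) k hk⟩
    · rintro ⟨m, hm, h⟩
      exact projective_of_ext_socle_eq_zero hdom hid I fun z => h.ext_eq_zero m _ n hm z
  refine ⟨main, ?_⟩
  funext I
  exact propext ⟨fun h => ⟨h.1, h.2.2, (main I h.1 h.2.2).1 h.2.1⟩,
    fun h => ⟨h.1, (main I h.1 h.2.1).2 h.2.2, h.2.1⟩⟩
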